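/- **Proposition (Fixed-point relocator for distributed forward-backward methods).** Let $X$ be a real Hilbert space, $n\ge 2$, $m\ge 0$, $p\ge 1$, and equip $X^k$ with the norm $\|\mathbf x\|=(\sum_i\|x_i\|^2)^{1/2}$. Let $A_1,\dots,A_n$ be maximally monotone set-valued operators on $X$, let $\beta>0$, and let $B_1,\dots,B_p:X\to X$ be $\beta$-cocoercive, i.e. $\langle B_jx-B_jy,x-y\rangle\ge\frac1\beta\|B_jx-B_jy\|^2$ for all $x,y\in X$. Let $d_1,\dots,d_n>0$, $M\in\mathbb R^{n\times m}$, $N\in\mathbb R^{n\times n}$, $P\in\mathbb R^{n\times p}$, $R\in\mathbb R^{p\times n}$ be such that - (i) $\ker(M^*)=\mathbb R\mathbf 1$; - (v) $\sum_{i,j=1}^nN_{ij}=\sum_{i=1}^nd_i$; - (vi) $N$ and $P$ are lower triangular with zeros on the diagonal, and $R$ is lower triangular. Write $\mathbf M=M\otimes\mathrm{Id}:X^m\to X^n$, and similarly $\mathbf N,\mathbf P,\mathbf R$; $\|\cdot\|$ of these is the operator norm, $\mathbf M^*$ is the adjoint and $\mathbf M^\dagger$ the Moore--Penrose pseudo-inverse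 of $\mathbf M$. Let $J_A=(\mathrm{Id}+A)^{-1}$ denote the resolvent. Fix $\tau\in\{0,1\}$ (with $\tau=1$ the innermost sums below include the diagonal entries of $R$, with $\tau=0$ they do not). For $\gamma>0$ and $\mathbf z\in X^m$ define $\mathbf x^\gamma(\mathbf z)=(\mathbf x_1^\gamma(\mathbf z),\dots,\mathbf x_n^\gamma(\mathbf z))\in X^n$ recursively, for $i=1,\dots,n$ (empty sums being $0$), by $$\mathbf x_i^\gamma(\mathbf z)=J_{\frac{\gamma}{d_i}A_i}\Big(\tfrac1{d_i}(\mathbf M\mathbf z)_i+\tfrac1{d_i}\sum_{j=1}^{i-1}N_{ij}\mathbf x_j^\gamma(\mathbf z)-\tfrac{\gamma}{d_i}\sum_{j=1}^{\min\{i-1,p\}}P_{ij}B_j\Big(\sum_{t=1}^{j-1+\tau}R_{jt}\mathbf x_t^\gamma(\mathbf z)\Big)\Big),$$ and, for $\theta>0$, put $T_{\theta,\gamma}\mathbf z=\mathbf z-\theta\,\mathbf M^*\mathbf x^\gamma(\mathbf z)$. Let $$\mathbf e^\gamma(\mathbf z)=P_{\mathrm{range}(\mathbf M)}\Big(d_i\mathbf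 x_i^\gamma(\mathbf z)-\sum_{j=1}^{i-1}N_{ij}\mathbf x_j^\gamma(\mathbf z)\Big)_{i=1}^n,\qquad Q_{\delta\leftarrow\gamma}\mathbf z=\tfrac\delta\gamma\mathbf z+\Big(1-\tfrac\delta\gamma\Big)\mathbf M^\dagger\mathbf e^\gamma(\mathbf z)\qquad(\gamma,\delta>0).$$ Finally define recursively, for $i=1,\dots,n$, $$C_i(\gamma)=\sqrt m\,\|\mathbf M\|+\|\mathbf N\|\sum_{j=1}^{i-1}\frac{C_j(\gamma)}{d_j}+\gamma\beta\|\mathbf P\|\|\mathbf R\|\sum_{j=1}^{\min\{i-1,p\}}\sum_{t=1}^{j-1+\tau}\frac{C_t(\gamma)}{d_t}$$ (so $C_1(\gamma)=\sqrt m\,\|\mathbf M\|$), and $$\mathcal L_{\delta\leftarrow\gamma}=\max\Big\{1,\ \frac\delta\gamma+\Big|1-\frac\delta\gamma\Big|\,\|\mathbf M^\dagger\|\sqrt{C_1(\gamma)^2+\sum_{i=2}^n\Big(C_i(\gamma)+\|\mathbf N\|\sum_{j=1}^{i-1}\frac{C_j(\gamma)}{d_j}\Big)^2}\Big\}.$$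 Then, for every $\theta>0$, $(Q_{\delta\leftarrow\gamma})_{\gamma,\delta>0}$ defines fixed-point relocators for $(T_{\theta,\gamma})_{\gamma>0}$ with Lipschitz constants $\mathcal L_{\delta\leftarrow\gamma}\in[1,\infty)$; that is, for all $\gamma,\delta,\varepsilon>0$: 1. $Q_{\delta\leftarrow\gamma}$ restricts to a bijection from $\mathrm{Fix}\,T_{\theta,\gamma}$ onto $\mathrm{Fix}\,T_{\theta,\delta}$; 2. for every $\mathbf z\in\mathrm{Fix}\,T_{\theta,\gamma}$, the map $(0,\infty)\ni\delta\mapsto Q_{\delta\leftarrow\gamma}\mathbf z$ is continuous; 3. $Q_{\varepsilon\leftarrow\delta}Q_{\delta\leftarrow\gamma}\mathbf z=Q_{\varepsilon\leftarrow\gamma}\mathbf z$ for every $\mathbf z\in\mathrm{Fix}\,T_{\theta,\gamma}$; 4. $Q_{\delta\leftarrow\gamma}$ is $\mathcal L_{\delta\leftarrow\gamma}$-Lipschitz continuous on $X^m$. -/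

import Mathlib

namespace DFB

noncomputable section

/-! ### Monotone operators, resolvents, projections, pseudo-inverses -/

section General

variable {E : Type*} [NormedAddCommGroup E] [InnerProductSpace ℝ E]

/-- A set-valued operator `A : E ⇉ E` is monotone. -/
def IsMonotoneOp (A : E → Set E) : Prop :=
  ∀ x u : E, ∀ y ∈ A x, ∀ v ∈ A u, 0 ≤ inner ℝ (x - u) (y - v)

/-- A set-valued operator is maximally monotone: it is monotone and has no proper monotone
extension. -/
def IsMaximallyMonotone (A : E → Set E) : Prop :=
  IsMonotoneOp A ∧ ∀ A' : E → Set E, IsMonotoneOp A' → (∀ x, A x ⊆ A' x) → A' = A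

/-- A single-valued operator is `β`-cocoercive, in the convention where the constant is `1 / β`. -/
def IsCocoercive (β : ℝ) (B : E → E) : Prop :=
  ∀ x y : E, (1 / β) * ‖B x - B y‖ ^ 2 ≤ inner ℝ (B x - B y) (x - y)

/-- The set-valued operator `c A`. -/
def scaleOp (c : ℝ) (A : E → Set E) : E → Set E := fun x => (fun v => c • v) '' A x

/-- The resolvent `J_A = (Id + A)⁻¹` as a single-valued map: `J_A x` is the point `y` with
`x ∈ y + A y`. (For a maximally monotone `A` on a Hilbert space there is exactly one such `y`;
when there is none the value is irrelevant.) -/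
def resolventMap (A : E → Set E) (x : E) : E := Classical.epsilon fun y => x - y ∈ A y

/-- The projection of `x` onto the set `C`: the point of `C` nearest to `x`. (It exists and is
unique when `C` is nonempty, closed and convex.) -/
def projOnto (C : Set E) (x : E) : E :=
  Classical.epsilon fun y => y ∈ C ∧ ∀ c ∈ C, ‖y - x‖ ≤ ‖c - x‖

variable {F : Type*} [NormedAddCommGroup F] [InnerProductSpace ℝ F]
  [CompleteSpace E] [CompleteSpace F]

/-- `S` is a Moore--Penrose inverse of the bounded operator `T`: the four Penrose equations. -/
def IsMoorePenrose (T : E →L[ℝ] F) (S : F →L[ℝ] E) : Prop :=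
  T ∘L S ∘L T = T ∧ S ∘L T ∘L S = S ∧ IsSelfAdjoint (T ∘L S) ∧ IsSelfAdjoint (S ∘L T)

/-- The Moore--Penrose pseudo-inverse `T†` of a bounded operator. (A solution of the four Penrose
equations is unique, and exists exactly when `T` has closed range.) -/
def pinv (T : E →L[ℝ] F) : F →L[ℝ] E := Classical.epsilon fun S => IsMoorePenrose T S

end General

/-! ### Fixed-point relocators -/

/-- The family `Q δ γ` (for `Q_{δ ← γ}`), `δ, γ ∈ Γ`, defines fixed-point relocators for the family
`(T γ)`, `γ ∈ Γ`, with Lipschitz constants `L δ γ ∈ [1, ∞)`. -/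
structure IsFixedPointRelocator {E : Type*} [NormedAddCommGroup E] (Γ : Set ℝ)
    (T : ℝ → E → E) (Q : ℝ → ℝ → E → E) (L : ℝ → ℝ → ℝ) : Prop where
  one_le : ∀ γ ∈ Γ, ∀ δ ∈ Γ, 1 ≤ L δ γ
  bijOn : ∀ γ ∈ Γ, ∀ δ ∈ Γ,
    Set.BijOn (Q δ γ) (Function.fixedPoints (T γ)) (Function.fixedPoints (T δ))
  continuousOn : ∀ γ ∈ Γ, ∀ x ∈ Function.fixedPoints (T γ), ContinuousOn (fun δ => Q δ γ x) Γ
  semigroup : ∀ γ ∈ Γ, ∀ δ ∈ Γ, ∀ ε ∈ Γ, ∀ x ∈ Function.fixedPoints (T γ),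
    Q ε δ (Q δ γ x) = Q ε γ x
  lipschitz : ∀ γ ∈ Γ, ∀ δ ∈ Γ, ∀ x y : E, ‖Q δ γ x - Q δ γ y‖ ≤ L δ γ * ‖x - y‖

/-! ### Product spaces and matrices acting on them -/

/-- The Hilbert space `X ^ k` with the `ℓ²` norm. -/
abbrev Pow (X : Type*) (k : ℕ) : Type _ := PiLp 2 (fun _ : Fin k => X)

variable {X : Type*} [NormedAddCommGroup X] [InnerProductSpace ℝ X]

variable (X) in
/-- The bounded operator `M ⊗ Id : X ^ b → X ^ a` induced by a real matrix `M`. -/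
def kron {a b : ℕ} (M : Matrix (Fin a) (Fin b) ℝ) : Pow X b →L[ℝ] Pow X a :=
  ((PiLp.continuousLinearEquiv 2 ℝ (fun _ : Fin a => X)).symm : (Fin a → X) →L[ℝ] Pow X a) ∘L
    ContinuousLinearMap.pi fun i => ∑ j, M i j • PiLp.proj 2 (fun _ : Fin b => X) j

theorem kron_apply {a b : ℕ} (M : Matrix (Fin a) (Fin b) ℝ) (z : Pow X b) (i : Fin a) :
    kron X M z i = ∑ j, M i j • z j := by
  simp [kron]

/-! ### The distributed forward-backward operators -/

/-- Coefficients of a distributed forward-backward method: the diagonal `d` of `D`, and the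
matrices `M, N, P, R`. -/
structure Coeffs (n m p : ℕ) where
  /-- diagonal entries of `D` -/
  d : Fin n → ℝ
  /-- the matrix `M` -/
  M : Matrix (Fin n) (Fin m) ℝ
  /-- the matrix `N` -/
  N : Matrix (Fin n) (Fin n) ℝ
  /-- the matrix `P` -/
  P : Matrix (Fin n) (Fin p) ℝ
  /-- the matrix `R` -/
  R : Matrix (Fin p) (Fin n) ℝ

variable {n m p : ℕ}

/-- `ker(M^*)` is the line spanned by the all-ones vector. -/
def Coeffs.KerCondition (K : Coeffs n m p) : Prop :=
  LinearMap.ker (Matrix.toLin' K.M.transpose) = Submodule.span ℝ {(1 : Fin n → ℝ)}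

/-- The entries of `N` sum up to `d_1 + ⋯ + d_n`. -/
def Coeffs.SumCondition (K : Coeffs n m p) : Prop :=
  ∑ i, ∑ j, K.N i j = ∑ i, K.d i

/-- `N` and `P` are lower triangular with zeros on the diagonal, and `R` is lower triangular. -/
def Coeffs.TriangularCondition (K : Coeffs n m p) : Prop :=
  (∀ (i : Fin n) (j : Fin n), i.val ≤ j.val → K.N i j = 0) ∧
  (∀ (i : Fin n) (j : Fin p), i.val ≤ j.val → K.P i j = 0) ∧
  (∀ (j : Fin p) (t : Fin n), j.val < t.val → K.R j t = 0)

/-- The components `x_i^γ(z)`, computed one after the other. Indices start at `0` here, so that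
`j < i` stands for `j ≤ i - 1`; sums over an empty range vanish, which covers the first component.
The parameter `τ ∈ {0, 1}` fixes where the innermost sum stops: in one-based indices it runs over
`1 ≤ t ≤ j - 1 + τ`, so `τ = 1` includes the diagonal entry of `R` and `τ = 0` leaves it out. -/
def xComp (τ : Fin 2) (K : Coeffs n m p) (A : Fin n → X → Set X) (B : Fin p → X → X)
    (γ : ℝ) (z : Pow X m) (i : Fin n) : X :=
  resolventMap (scaleOp (γ / K.d i) (A i))
    ((1 / K.d i) • kron X K.M z i
      + (1 / K.d i) • ∑ j : {j : Fin n // j.val < i.val}, K.N i j.1 • xComp τ K A B γ z j.1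
      - (γ / K.d i) • ∑ j : {j : Fin p // j.val < i.val}, K.P i j.1 •
          B j.1 (∑ t : {t : Fin n // t.val < j.1.val + τ.val},
            K.R j.1 t.1 • xComp τ K A B γ z t.1))
termination_by i.val
decreasing_by
  · exact j.2
  · have _h1 := t.2
    have _h2 := j.2
    have _h3 := τ.2
    omega

/-- The map `x^γ : X ^ m → X ^ n`. -/
def xMap (τ : Fin 2) (K : Coeffs n m p) (A : Fin n → X → Set X) (B : Fin p → X → X)
    (γ : ℝ) (z : Pow X m) : Pow X n :=
  WithLp.toLp 2 (xComp τ K A B γ z)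

/-- `T_{θ,γ} z = z - θ M^* x^γ(z)`. -/
def fbOp [CompleteSpace X] (τ : Fin 2) (K : Coeffs n m p) (A : Fin n → X → Set X)
    (B : Fin p → X → X) (θ γ : ℝ) (z : Pow X m) : Pow X m :=
  z - θ • ContinuousLinearMap.adjoint (kron X K.M) (xMap τ K A B γ z)

/-- `e^γ(z)`, the projection of `(d_i x_i^γ(z) - ∑_{j ≤ i-1} N_{ij} x_j^γ(z))_i` onto the range
of `M ⊗ Id`. -/
def eMap (τ : Fin 2) (K : Coeffs n m p) (A : Fin n → X → Set X) (B : Fin p → X → X)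
    (γ : ℝ) (z : Pow X m) : Pow X n :=
  projOnto (Set.range (kron X K.M))
    (WithLp.toLp 2 fun i => K.d i • xMap τ K A B γ z i
      - ∑ j : {j : Fin n // j.val < i.val}, K.N i j.1 • xMap τ K A B γ z j.1)

/-- `Q_{δ ← γ} z = (δ/γ) z + (1 - δ/γ) M† e^γ(z)`. -/
def relocator [CompleteSpace X] (τ : Fin 2) (K : Coeffs n m p) (A : Fin n → X → Set X)
    (B : Fin p → X → X) (δ γ : ℝ) (z : Pow X m) : Pow X m :=
  (δ / γ) • z + (1 - δ / γ) • pinv (kron X K.M) (eMap τ K A B γ z)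

variable (X) in
/-- The constants `C_i(γ)`, by recursion on `i`; the norms are operator norms of `M ⊗ Id` etc. For
the first index all sums are empty and the value is `√m ‖M ⊗ Id‖`. -/
def lipC (τ : Fin 2) (K : Coeffs n m p) (β γ : ℝ) (i : Fin n) : ℝ :=
  √(m : ℝ) * ‖kron X K.M‖
    + ‖kron X K.N‖ * ∑ j : {j : Fin n // j.val < i.val}, lipC τ K β γ j.1 / K.d j.1
    + γ * β * ‖kron X K.P‖ * ‖kron X K.R‖ *
        ∑ j : {j : Fin p // j.val < i.val}, ∑ t : {t : Fin n // t.val < j.1.val + τ.val},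
          lipC τ K β γ t.1 / K.d t.1
termination_by i.val
decreasing_by
  · exact j.2
  · have _h1 := t.2
    have _h2 := j.2
    have _h3 := τ.2
    omega

variable (X) in
/-- The Lipschitz constants `L_{δ ← γ}`. (The summand of the first index is `C_1 ^ 2`.) -/
def lipL [CompleteSpace X] (τ : Fin 2) (K : Coeffs n m p) (β δ γ : ℝ) : ℝ :=
  max 1 (δ / γ + |1 - δ / γ| * ‖pinv (kron X K.M)‖ *
    √(∑ i : Fin n, (lipC X τ K β γ i
      + ‖kron X K.N‖ * ∑ j : {j : Fin n // j.val < i.val}, lipC X τ K β γ j.1 / K.d j.1) ^ 2))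

end

end DFB

/-!
The argument rests on a description of the fixed points of `T_{θ,γ}` in which `γ` enters
transparently. Since `ker M* = ℝ𝟏`, a point `z` is fixed exactly when all components of `x^γ(z)`
equal one point `x`. Unfolding the resolvents, this means
`γ⁻¹ ((M z)_i - a_i x) - f_i(x) ∈ A_i x` for all `i`, where `a_i = d_i - ∑_{j < i} N_{ij}` and
`f_i(x)` does not involve `γ` (`DFB.forall_xComp_eq_iff`). The numbers `a_i` sum up to zero, so
`(a_i x)_i` is orthogonal to `ker M*`, hence lies in the range of `M` and equals `e^γ(z)`.
Consequently `M Q_{δ ← γ} z - e = (δ/γ) (M z - e)` with `e = (a_i x)_i`, and the inclusions for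
`(γ, z)` and for `(δ, Q_{δ ← γ} z)` are the same: the relocator keeps the point `x`
(`DFB.xComp_relocator_eq`). The semigroup property is then a computation with scalars,
the inverse of `Q_{δ ← γ}` on the fixed points is `Q_{γ ← δ}`, and continuity in `δ` is clear.

The Lipschitz estimate follows the recursion defining `x^γ`, as resolvents and projections are
nonexpansive and cocoercive maps are Lipschitz (`DFB.norm_xComp_sub_le`, `DFB.norm_eMap_sub_le`).

Two general facts are needed. Minty's theorem says that the resolvent of a maximally monotone
operator is defined everywhere. By maximality it suffices to find `x` in all balls
`⟪x - u, x + v⟫ ≤ 0`, with `v ∈ A u`; such an `x` is the limit of a maximizing sequence for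
`s - ‖w‖²` over the convex hull of the points `(w, s) = ((u - v) / 2, -⟪u, v⟫)`, and the parallelogram
identity makes that sequence Cauchy. The second fact is the existence of `M†`, obtained
from a spectral decomposition of `Mᵀ M`; the projection onto the range of `M` is `M M†`.
-/

namespace DFB

/-! ### Minty's theorem and resolvents -/

section Minty

open Filter Topology

variable {E : Type*} [NormedAddCommGroup E] [InnerProductSpace ℝ E]

/-- A minimax statement for the functions `x ↦ ‖x‖² - 2⟪x, w⟫ + s`, `(w, s) ∈ C`: the minimum
over `x` of such a function is `s - ‖w‖²`, and if none of these minima is positive, all the functions are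
nonpositive at a common point. -/
theorem exists_forall_sq_norm_sub_le_zero_of_convex [CompleteSpace E] {C : Set (E × ℝ)}
    (hC : Convex ℝ C) (h : ∀ q ∈ C, q.2 ≤ ‖q.1‖ ^ 2) :
    ∃ x : E, ∀ q ∈ C, ‖x‖ ^ 2 - 2 * inner ℝ x q.1 + q.2 ≤ 0 := by
  rcases C.eq_empty_or_nonempty with rfl | hne
  · exact ⟨0, by simp⟩
  set φ : E × ℝ → ℝ := fun q => q.2 - ‖q.1‖ ^ 2 with hφ
  have hbdd : BddAbove (φ '' C) := ⟨0, by rintro _ ⟨q, hq, rfl⟩; simpa [hφ] using h q hq⟩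
  have hle : ∀ q ∈ C, φ q ≤ sSup (φ '' C) := fun q hq => le_csSup hbdd ⟨q, hq, rfl⟩
  -- The `k`-th point is chosen `t k ^ 2`-optimal, so that a step of length `t k` can be divided out.
  set t : ℕ → ℝ := fun k => 1 / ((k : ℝ) + 1) with ht
  have htpos : ∀ k, 0 < t k := fun k => Nat.one_div_pos_of_nat
  have htle : ∀ k, t k ≤ 1 := fun k => by
    have : (0 : ℝ) ≤ k := k.cast_nonneg
    rw [ht]; exact div_le_one_of_le₀ (by linarith) (by linarith)
  have htlim : Tendsto t atTop (𝓝 0) := tendsto_one_div_add_atTop_nhds_zero_nat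
  have hex : ∀ k, ∃ q ∈ C, sSup (φ '' C) - t k ^ 2 < φ q := fun k => by
    obtain ⟨_, ⟨q, hq, rfl⟩, hlt⟩ := exists_lt_of_lt_csSup (hne.image φ)
      (sub_lt_self (sSup (φ '' C)) (pow_pos (htpos k) 2))
    exact ⟨q, hq, hlt⟩
  choose q hqC hq using hex
  -- By the parallelogram identity the midpoint of two almost maximizing points would beat the
  -- supremum if their first components were far apart.
  have hcauchy : CauchySeq fun k => (q k).1 := by
    refine cauchySeq_of_le_tendsto_0 (fun k => 2 * t k) (fun k l N hk hl => ?_)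
      (by simpa using htlim.const_mul 2)
    have hmid := hle _ (hC (hqC k) (hqC l) (by norm_num : (0 : ℝ) ≤ 1 / 2)
      (by norm_num : (0 : ℝ) ≤ 1 / 2) (by norm_num))
    have hk' : t k ≤ t N := Nat.one_div_le_one_div hk
    have hl' : t l ≤ t N := Nat.one_div_le_one_div hl
    have hks : t k ^ 2 ≤ t N ^ 2 := pow_le_pow_left₀ (htpos k).le hk' 2
    have hls : t l ^ 2 ≤ t N ^ 2 := pow_le_pow_left₀ (htpos l).le hl' 2
    have h1 := hq k
    have h2 := hq l
    rw [dist_eq_norm]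
    refine (sq_le_sq₀ (norm_nonneg _) (by linarith [htpos N])).1 ?_
    simp only [hφ, Prod.fst_add, Prod.snd_add, Prod.smul_fst, Prod.smul_snd, smul_eq_mul,
      ← smul_add, norm_smul] at hmid h1 h2
    rw [mul_pow, norm_add_sq_real] at hmid
    rw [norm_sub_sq_real]
    norm_num at hmid
    nlinarith
  obtain ⟨x, hx⟩ := cauchySeq_tendsto_of_complete hcauchy
  refine ⟨x, fun r hr => ?_⟩
  -- Moving from `q k` towards `r` by the step `t k` gains at most `t k ^ 2`.
  have hstep : ∀ k, ‖(q k).1‖ ^ 2 - 2 * inner ℝ (q k).1 r.1 + r.2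
      ≤ t k * (1 + ‖r.1 - (q k).1‖ ^ 2) := fun k => by
    have hmove := hle _ (hC (hqC k) hr (sub_nonneg.2 (htle k)) (htpos k).le (by ring))
    have h1 := hq k
    have h2 := h _ (hqC k)
    have e1 : ((1 - t k) • q k + t k • r).1 = (q k).1 + t k • (r.1 - (q k).1) := by
      simp only [Prod.fst_add, Prod.smul_fst]; module
    have e2 : ((1 - t k) • q k + t k • r).2 = (1 - t k) * (q k).2 + t k * r.2 := by simp
    simp only [hφ, e1, e2] at hmove h1
    rw [norm_add_sq_real, norm_smul, inner_smul_right, inner_sub_right,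
      real_inner_self_eq_norm_sq, mul_pow, Real.norm_eq_abs, sq_abs] at hmove
    refine le_of_mul_le_mul_left ?_ (htpos k)
    nlinarith [mul_le_mul_of_nonneg_left h2 (htpos k).le]
  refine le_of_tendsto_of_tendsto' (b := atTop) ?_ ?_ hstep
  · exact ((hx.norm.pow 2).sub ((hx.inner tendsto_const_nhds).const_mul 2)).add_const _
  · simpa using htlim.mul (((tendsto_const_nhds.sub hx).norm.pow 2).const_add 1)

/-- Averaging `⟪u, v⟫` over points of the graph of a monotone operator gives at least the inner
product of the averages. -/
theorem IsMonotoneOp.inner_le_of_mem_convexHull {A : E → Set E} (hA : IsMonotoneOp A)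
    {q : E × E × ℝ}
    (hq : q ∈ convexHull ℝ {q : E × E × ℝ | q.2.1 ∈ A q.1 ∧ q.2.2 = inner ℝ q.1 q.2.1}) :
    inner ℝ q.1 q.2.1 ≤ q.2.2 := by
  set G : Set (E × E × ℝ) := {q | q.2.1 ∈ A q.1 ∧ q.2.2 = inner ℝ q.1 q.2.1}
  have hconv : ∀ r : E × E × ℝ, Convex ℝ {s : E × E × ℝ |
      0 ≤ r.2.2 - inner ℝ r.1 s.2.1 - inner ℝ s.1 r.2.1 + s.2.2} := by
    intro r s hs s' hs' a b ha hb hab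
    simp only [Set.mem_ofPred_eq, Prod.fst_add, Prod.snd_add, Prod.smul_fst, Prod.smul_snd,
      smul_eq_mul, inner_add_left, inner_add_right, real_inner_smul_left,
      real_inner_smul_right] at hs hs' ⊢
    obtain rfl : b = 1 - a := by linarith
    nlinarith [mul_nonneg ha hs, mul_nonneg hb hs']
  have hG2 : ∀ r ∈ G, ∀ s ∈ convexHull ℝ G,
      0 ≤ r.2.2 - inner ℝ r.1 s.2.1 - inner ℝ s.1 r.2.1 + s.2.2 := fun r hr s hs =>
    convexHull_min (fun s hs => by
      have := hA _ _ _ hr.1 _ hs.1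
      rw [inner_sub_left, inner_sub_right, inner_sub_right] at this
      rw [Set.mem_ofPred_eq, hr.2, hs.2]
      linarith) (hconv r) hs
  have := convexHull_min (fun r hr => by
      have := hG2 r hr q hq
      rw [Set.mem_ofPred_eq]
      linarith) (hconv q) hq
  rw [Set.mem_ofPred_eq] at this
  linarith

/-- The closed balls with diameters `[u, -v]`, for `v ∈ A u`, have a common point when `A` is
monotone. -/
theorem IsMonotoneOp.exists_forall_inner_le_zero [CompleteSpace E] {A : E → Set E}
    (hA : IsMonotoneOp A) : ∃ x : E, ∀ u, ∀ v ∈ A u, inner ℝ (x - u) (x + v) ≤ 0 := by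
  set G : Set (E × E × ℝ) := {q | q.2.1 ∈ A q.1 ∧ q.2.2 = inner ℝ q.1 q.2.1}
  let L : E × E × ℝ →ₗ[ℝ] E × ℝ :=
    ((2⁻¹ : ℝ) • (LinearMap.fst ℝ E (E × ℝ) -
      LinearMap.fst ℝ E ℝ ∘ₗ LinearMap.snd ℝ E (E × ℝ))).prod
      (-(LinearMap.snd ℝ E ℝ ∘ₗ LinearMap.snd ℝ E (E × ℝ)))
  have hLq : ∀ q, L q = ((2⁻¹ : ℝ) • (q.1 - q.2.1), -q.2.2) := fun _ => rfl
  obtain ⟨x, hx⟩ := exists_forall_sq_norm_sub_le_zero_of_convex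
    ((convex_convexHull ℝ G).linear_image L) (by
      rintro _ ⟨q, hq, rfl⟩
      have := hA.inner_le_of_mem_convexHull hq
      have h0 := sq_nonneg ‖q.1 + q.2.1‖
      rw [norm_add_sq_real] at h0
      simp only [hLq, norm_smul, mul_pow, norm_sub_sq_real]
      norm_num
      linarith)
  refine ⟨x, fun u v hv => ?_⟩
  have := hx _ ⟨(u, v, inner ℝ u v), subset_convexHull ℝ G ⟨hv, rfl⟩, rfl⟩
  simp only [hLq, real_inner_smul_right, inner_sub_right] at this
  rw [inner_sub_left, inner_add_right, inner_add_right, real_inner_self_eq_norm_sq,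
    real_inner_comm x u]
  linarith

/-- **Minty's theorem**: `Id + A` is surjective for a maximally monotone `A` on a Hilbert space. -/
theorem IsMaximallyMonotone.exists_sub_mem [CompleteSpace E] {A : E → Set E}
    (hA : IsMaximallyMonotone A) (y : E) : ∃ x, y - x ∈ A x := by
  obtain ⟨x, hx⟩ := IsMonotoneOp.exists_forall_inner_le_zero (A := fun u => {v | v + y ∈ A u})
    (fun u u' v hv v' hv' => by simpa using hA.1 u u' _ hv _ hv')
  have hx' : ∀ u, ∀ v ∈ A u, 0 ≤ inner ℝ (x - u) (y - x - v) := fun u v hv => by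
    have := hx u (v - y) (by simpa using hv)
    rw [← neg_nonneg, ← inner_neg_right] at this
    convert this using 2
    abel
  -- Adding `(x, y - x)` to the graph keeps `A` monotone, so by maximality it is there already.
  refine ⟨x, ?_⟩
  rw [← hA.2 (fun u => A u ∪ {v | u = x ∧ v = y - x}) ?_ fun u => Set.subset_union_left]
  · exact Or.inr ⟨rfl, rfl⟩
  · rintro u u' v (hv | ⟨rfl, rfl⟩) v' (hv' | ⟨rfl, rfl⟩)
    · exact hA.1 _ _ _ hv _ hv'
    · rw [← inner_neg_neg, neg_sub, neg_sub]
      exact hx' _ _ hv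
    · exact hx' _ _ hv'
    · simp

theorem mem_scaleOp {c : ℝ} (hc : c ≠ 0) {A : E → Set E} {x y : E} :
    y ∈ scaleOp c A x ↔ c⁻¹ • y ∈ A x := by
  constructor
  · rintro ⟨v, hv, rfl⟩
    simpa [smul_smul, hc] using hv
  · exact fun h => ⟨_, h, by simp [smul_smul, hc]⟩

theorem IsMonotoneOp.scaleOp {c : ℝ} (hc : 0 < c) {A : E → Set E} (hA : IsMonotoneOp A) :
    IsMonotoneOp (scaleOp c A) := by
  rintro x u _ ⟨y, hy, rfl⟩ _ ⟨v, hv, rfl⟩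
  rw [← smul_sub, real_inner_smul_right]
  exact mul_nonneg hc.le (hA x u y hy v hv)

theorem IsMaximallyMonotone.scaleOp {c : ℝ} (hc : 0 < c) {A : E → Set E}
    (hA : IsMaximallyMonotone A) : IsMaximallyMonotone (scaleOp c A) := by
  refine ⟨hA.1.scaleOp hc, fun A' hA' hsub => ?_⟩
  have := hA.2 _ (hA'.scaleOp (inv_pos.2 hc)) fun x v hv => by
    rw [mem_scaleOp (inv_pos.2 hc).ne', inv_inv]
    exact hsub x ⟨v, hv, rfl⟩
  ext x y
  rw [mem_scaleOp hc.ne', ← this, mem_scaleOp (inv_pos.2 hc).ne']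
  simp [smul_smul, hc.ne']

theorem IsMaximallyMonotone.sub_resolventMap_mem [CompleteSpace E] {A : E → Set E}
    (hA : IsMaximallyMonotone A) (x : E) : x - resolventMap A x ∈ A (resolventMap A x) :=
  Classical.epsilon_spec (hA.exists_sub_mem x)

theorem IsMonotoneOp.norm_sub_le {A : E → Set E} (hA : IsMonotoneOp A) {x y u v : E}
    (hu : x - u ∈ A u) (hv : y - v ∈ A v) : ‖u - v‖ ≤ ‖x - y‖ := by
  have h := hA _ _ _ hu _ hv
  have e : x - u - (y - v) = (x - y) - (u - v) := by abel
  rw [e, inner_sub_right, real_inner_self_eq_norm_sq] at h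
  have h2 := real_inner_le_norm (u - v) (x - y)
  by_contra! hlt
  nlinarith [norm_nonneg (x - y), norm_nonneg (u - v)]

theorem IsMaximallyMonotone.resolventMap_eq_iff [CompleteSpace E] {A : E → Set E}
    (hA : IsMaximallyMonotone A) {x y : E} : resolventMap A x = y ↔ x - y ∈ A y := by
  refine ⟨?_, fun h => ?_⟩
  · rintro rfl
    exact hA.sub_resolventMap_mem x
  · simpa [sub_eq_zero] using hA.1.norm_sub_le (hA.sub_resolventMap_mem x) h

theorem IsMaximallyMonotone.norm_resolventMap_sub_le [CompleteSpace E] {A : E → Set E}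
    (hA : IsMaximallyMonotone A) (x y : E) :
    ‖resolventMap A x - resolventMap A y‖ ≤ ‖x - y‖ :=
  hA.1.norm_sub_le (hA.sub_resolventMap_mem x) (hA.sub_resolventMap_mem y)

theorem IsCocoercive.norm_sub_le {β : ℝ} (hβ : 0 < β) {B : E → E} (hB : IsCocoercive β B)
    (x y : E) : ‖B x - B y‖ ≤ β * ‖x - y‖ := by
  have h := (hB x y).trans (real_inner_le_norm _ _)
  rw [one_div, inv_mul_le_iff₀ hβ] at h
  by_contra! hlt
  have : 0 < ‖B x - B y‖ := lt_of_le_of_lt (by positivity) hlt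
  nlinarith

end Minty

/-! ### Moore--Penrose inverses of `M ⊗ Id` -/

section PseudoInverse

open Matrix

/-- A real symmetric matrix has a symmetric Moore--Penrose inverse, which commutes with it: invert
its nonzero eigenvalues. -/
theorem exists_commuting_generalized_inverse {ι : Type*} [Fintype ι]
    [DecidableEq ι] {H : Matrix ι ι ℝ} (hH : H.IsHermitian) :
    ∃ G : Matrix ι ι ℝ, G.IsHermitian ∧ H * G * H = H ∧ G * H * G = G ∧ G * H = H * G := by
  obtain ⟨φ, v, rfl⟩ : ∃ (φ : Matrix ι ι ℝ ≃⋆ₐ[ℝ] Matrix ι ι ℝ) (v : ι → ℝ), H = φ (diagonal v) :=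
    ⟨_, _, hH.spectral_theorem⟩
  have h1 : (fun i => v i * v⁻¹ i * v i) = v := funext fun i => mul_inv_mul_cancel (v i)
  have h2 : (fun i => v⁻¹ i * v i * v⁻¹ i) = v⁻¹ := funext fun i => by
    simpa using mul_inv_mul_cancel (v i)⁻¹
  refine ⟨φ (diagonal v⁻¹), ?_, ?_, ?_, ?_⟩
  · rw [Matrix.IsHermitian, ← star_eq_conjTranspose, ← map_star, star_eq_conjTranspose,
      diagonal_conjTranspose, star_trivial]
  · rw [← map_mul, ← map_mul, diagonal_mul_diagonal, diagonal_mul_diagonal, h1]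
  · rw [← map_mul, ← map_mul, diagonal_mul_diagonal, diagonal_mul_diagonal, h2]
  · simp only [← map_mul, diagonal_mul_diagonal, mul_comm]

variable {X : Type*} [NormedAddCommGroup X] [InnerProductSpace ℝ X] {a b c : ℕ}

theorem kron_mul (S : Matrix (Fin a) (Fin b) ℝ) (T : Matrix (Fin b) (Fin c) ℝ) :
    kron X (S * T) = kron X S ∘L kron X T := by
  ext z i
  simp only [ContinuousLinearMap.comp_apply, kron_apply, Matrix.mul_apply, Finset.sum_smul,
    Finset.smul_sum, smul_smul]
  exact Finset.sum_comm

theorem inner_kron_left (S : Matrix (Fin a) (Fin b) ℝ) (x : Pow X b) (y : Pow X a) :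
    inner ℝ (kron X S x) y = inner ℝ x (kron X Sᵀ y) := by
  simp only [PiLp.inner_apply, kron_apply, sum_inner, inner_sum, real_inner_smul_left,
    real_inner_smul_right, Matrix.transpose_apply]
  exact Finset.sum_comm

theorem adjoint_kron [CompleteSpace X] (S : Matrix (Fin a) (Fin b) ℝ) :
    ContinuousLinearMap.adjoint (kron X S) = kron X Sᵀ :=
  ((ContinuousLinearMap.eq_adjoint_iff _ _).2 fun x y => by
    rw [inner_kron_left, Matrix.transpose_transpose]).symm

/-- The usual bound `|S i j| ≤ ‖S ⊗ Id‖` fails when `X` is trivial; this form holds for every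
`X`. -/
theorem norm_smul_le_norm_kron (S : Matrix (Fin a) (Fin b) ℝ) (i : Fin a) (j : Fin b) (x : X) :
    ‖S i j • x‖ ≤ ‖kron X S‖ * ‖x‖ := by
  have h := (kron X S).le_opNorm (PiLp.single 2 j x)
  rw [PiLp.norm_single] at h
  refine le_trans ?_ ((PiLp.norm_apply_le _ i).trans h)
  simp [kron_apply]

/-- If `G` is the Moore--Penrose inverse of `Mᵀ M`, then `(G Mᵀ) ⊗ Id` is that of `M ⊗ Id`. -/
theorem exists_isMoorePenrose_kron [CompleteSpace X] (M : Matrix (Fin a) (Fin b) ℝ) :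
    ∃ S, IsMoorePenrose (kron X M) S := by
  have hH : (Mᵀ * M).IsHermitian := by
    simp [Matrix.IsHermitian, conjTranspose_eq_transpose_of_trivial]
  obtain ⟨G, hG, h1, h2, h3⟩ :=
    exists_commuting_generalized_inverse hH
  rw [Matrix.IsHermitian, conjTranspose_eq_transpose_of_trivial] at hG
  have hM : M * G * Mᵀ * M = M := by
    -- `Mᴴ * M * C = 0` implies `M * C = 0`, here for `C = G * (Mᵀ * M) - 1`.
    have h0 : Mᴴ * M * (G * (Mᵀ * M) - 1) = 0 := by
      rw [conjTranspose_eq_transpose_of_trivial, Matrix.mul_sub, ← Matrix.mul_assoc, h1,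
        Matrix.mul_one, sub_self]
    rw [conjTranspose_mul_self_mul_eq_zero, Matrix.mul_sub, Matrix.mul_one, sub_eq_zero] at h0
    simpa only [Matrix.mul_assoc] using h0
  refine ⟨kron X (G * Mᵀ), ?_, ?_, ?_, ?_⟩
  · rw [← kron_mul, ← kron_mul]
    congr 1
    simpa [Matrix.mul_assoc] using hM
  · rw [← kron_mul, ← kron_mul]
    congr 1
    simp only [← Matrix.mul_assoc] at h2 ⊢
    rw [h2]
  · rw [← kron_mul, ContinuousLinearMap.isSelfAdjoint_iff', adjoint_kron]
    simp [transpose_mul, hG, Matrix.mul_assoc]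
  · rw [← kron_mul, ContinuousLinearMap.isSelfAdjoint_iff', adjoint_kron, Matrix.mul_assoc, h3,
      transpose_mul, hG, ← h3]
    simp [transpose_mul]

end PseudoInverse

/-! ### Projection onto the range of an operator with a Moore--Penrose inverse -/

section Projection

variable {E F : Type*} [NormedAddCommGroup E] [InnerProductSpace ℝ E] [CompleteSpace E]
  [NormedAddCommGroup F] [InnerProductSpace ℝ F] [CompleteSpace F]

theorem IsMoorePenrose.apply_apply_apply {T : E →L[ℝ] F} {S : F →L[ℝ] E} (h : IsMoorePenrose T S)
    (x : E) : T (S (T x)) = T x :=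
  congrArg (· x) h.1

theorem IsMoorePenrose.inner_apply_comm {T : E →L[ℝ] F} {S : F →L[ℝ] E} (h : IsMoorePenrose T S)
    (x y : F) : inner ℝ (T (S x)) y = inner ℝ x (T (S y)) :=
  h.2.2.1.isSymmetric x y

theorem IsMoorePenrose.projOnto_range {T : E →L[ℝ] F} {S : F →L[ℝ] E} (h : IsMoorePenrose T S)
    (x : F) : projOnto (Set.range T) x = T (S x) := by
  have pyth : ∀ c ∈ Set.range T, ‖c - x‖ ^ 2 = ‖c - T (S x)‖ ^ 2 + ‖T (S x) - x‖ ^ 2 := by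
    rintro _ ⟨u, rfl⟩
    have h0 : inner ℝ (T u - T (S x)) (T (S x) - x) = 0 := by
      rw [← map_sub T, ← h.apply_apply_apply, h.inner_apply_comm, map_sub S, map_sub T (S _),
        h.apply_apply_apply, sub_self, inner_zero_right]
    rw [← sub_add_sub_cancel (T u) (T (S x)) x, norm_add_sq_real, h0]
    ring
  obtain ⟨hmem, hmin⟩ : projOnto (Set.range T) x ∈ Set.range T ∧
      ∀ c ∈ Set.range T, ‖projOnto (Set.range T) x - x‖ ≤ ‖c - x‖ :=
    Classical.epsilon_spec (p := fun y => y ∈ Set.range T ∧ ∀ c ∈ Set.range T, ‖y - x‖ ≤ ‖c - x‖)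
      ⟨T (S x), ⟨_, rfl⟩, fun c hc => by
        refine (sq_le_sq₀ (norm_nonneg _) (norm_nonneg _)).1 ?_
        rw [pyth c hc]
        linarith [sq_nonneg ‖c - T (S x)‖] ⟩
  have h1 := hmin _ ⟨S x, rfl⟩
  have h2 := pyth _ hmem
  have h3 := pow_le_pow_left₀ (norm_nonneg _) h1 2
  rw [← sub_eq_zero, ← norm_eq_zero, ← sq_eq_zero_iff]
  exact le_antisymm (by linarith) (sq_nonneg _)

theorem IsMoorePenrose.norm_apply_apply_le {T : E →L[ℝ] F} {S : F →L[ℝ] E}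
    (h : IsMoorePenrose T S) (x : F) : ‖T (S x)‖ ≤ ‖x‖ := by
  have h1 : ‖T (S x)‖ ^ 2 = inner ℝ (T (S x)) x := by
    rw [← real_inner_self_eq_norm_sq, ← h.inner_apply_comm, h.apply_apply_apply]
  have h2 := real_inner_le_norm (T (S x)) x
  by_contra! hlt
  nlinarith [norm_nonneg x]

end Projection

/-! ### Consequences of the kernel condition -/

section Kernel

open Matrix

variable {X : Type*} [NormedAddCommGroup X] [InnerProductSpace ℝ X] {n m p : ℕ}

theorem Coeffs.KerCondition.transpose_mulVec_eq_zero_iff {K : Coeffs n m p} (hK : K.KerCondition)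
    {v : Fin n → ℝ} : K.Mᵀ *ᵥ v = 0 ↔ ∃ c : ℝ, v = fun _ => c := by
  have h : v ∈ LinearMap.ker (Matrix.toLin' K.Mᵀ) ↔ v ∈ Submodule.span ℝ {(1 : Fin n → ℝ)} := by
    rw [← hK]
  rw [LinearMap.mem_ker, Matrix.toLin'_apply, Submodule.mem_span_singleton] at h
  rw [h]
  refine exists_congr fun c => ?_
  rw [eq_comm]
  congr! 1
  ext
  simp

theorem Coeffs.KerCondition.kron_transpose_eq_zero_iff {K : Coeffs n m p} (hK : K.KerCondition)
    (hn : 0 < n) {x : Pow X n} : kron X K.Mᵀ x = 0 ↔ ∃ y, ∀ i, x i = y := by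
  constructor
  · intro hx
    refine ⟨x ⟨0, hn⟩, fun i => ext_inner_right ℝ fun y => ?_⟩
    obtain ⟨c, hc⟩ := hK.transpose_mulVec_eq_zero_iff.1
      (show K.Mᵀ *ᵥ (fun i => inner ℝ (x i) y) = 0 by
        ext j
        have : inner ℝ (kron X K.Mᵀ x j) y = 0 := by rw [hx]; simp
        simpa [kron_apply, sum_inner, real_inner_smul_left, Matrix.mulVec, dotProduct] using this)
    exact (congrFun hc i).trans (congrFun hc _).symm
  · rintro ⟨y, hy⟩
    ext j
    have := congrFun (hK.transpose_mulVec_eq_zero_iff.2 ⟨1, rfl⟩) j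
    simp only [Matrix.mulVec, dotProduct, mul_one] at this
    simp only [kron_apply, hy, ← Finset.sum_smul, this]
    simp

variable [CompleteSpace X]

theorem isMoorePenrose_pinv_kron {a b : ℕ} (M : Matrix (Fin a) (Fin b) ℝ) :
    IsMoorePenrose (kron X M) (pinv (kron X M)) :=
  Classical.epsilon_spec (exists_isMoorePenrose_kron M)

/-- The range of `M ⊗ Id` contains all vectors whose components sum up to zero. -/
theorem Coeffs.KerCondition.kron_pinv_apply {K : Coeffs n m p} (hK : K.KerCondition) (hn : 0 < n)
    {e : Pow X n} (he : ∑ i, e i = 0) : kron X K.M (pinv (kron X K.M) e) = e := by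
  have hS := isMoorePenrose_pinv_kron (X := X) K.M
  set S := pinv (kron X K.M)
  -- The residual `r` is orthogonal to the range, hence constant, hence orthogonal to `e` too.
  set r := e - kron X K.M (S e) with hr
  have hker : kron X K.Mᵀ r = 0 := by
    refine ext_inner_left ℝ fun u => ?_
    rw [← inner_kron_left, inner_zero_right, hr, inner_sub_right, ← hS.inner_apply_comm,
      hS.apply_apply_apply, sub_self]
  obtain ⟨y, hy⟩ := (hK.kron_transpose_eq_zero_iff hn).1 hker
  have h1 : inner ℝ e r = 0 := by
    rw [PiLp.inner_apply]
    simp only [hy, ← sum_inner, he, inner_zero_left]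
  have h2 : inner ℝ r r = 0 := by
    nth_rewrite 1 [hr]
    rw [inner_sub_left, h1, inner_kron_left, hker, inner_zero_right, sub_zero]
  rw [inner_self_eq_zero, hr, sub_eq_zero] at h2
  exact h2.symm

end Kernel

/-! ### Fixed points and their relocation -/

section FixedPoints

variable {X : Type*} [NormedAddCommGroup X] [InnerProductSpace ℝ X] {n m p : ℕ}

/-- The number `a_i = d_i - ∑_{j < i} N_{ij}`. At a fixed point of `T_{θ,γ}`, where all components of
`x^γ(z)` equal `x`, the vector `e^γ(z)` is `(a_i x)_i`. -/
noncomputable def Coeffs.defect (K : Coeffs n m p) (i : Fin n) : ℝ :=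
  K.d i - ∑ j : {j : Fin n // j.val < i.val}, K.N i j.1

/-- The forward term `∑_{j < i} P_{ij} B_j(∑_{t < j + τ} R_{jt} x)` of the `i`-th step, for an input
all of whose components equal `x`. Indices start at `0`. -/
noncomputable def forwardTerm (τ : Fin 2) (K : Coeffs n m p) (B : Fin p → X → X) (x : X)
    (i : Fin n) : X :=
  ∑ j : {j : Fin p // j.val < i.val}, K.P i j.1 •
    B j.1 (∑ t : {t : Fin n // t.val < j.1.val + τ.val}, K.R j.1 t.1 • x)

theorem Coeffs.sum_defect {K : Coeffs n m p} (hsum : K.SumCondition)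
    (htri : K.TriangularCondition) : ∑ i, K.defect i = 0 := by
  have h : ∀ i, ∑ j : {j : Fin n // j.val < i.val}, K.N i j.1 = ∑ j, K.N i j := fun i => by
    rw [← Fintype.sum_subtype_add_sum_subtype (fun j : Fin n => j.val < i.val), left_eq_add]
    exact Finset.sum_eq_zero fun j _ => htri.1 i j (not_lt.1 j.2)
  simp only [Coeffs.defect, h, Finset.sum_sub_distrib]
  rw [hsum, sub_self]

variable {τ : Fin 2} {K : Coeffs n m p} {A : Fin n → X → Set X} {B : Fin p → X → X}

theorem xComp_eq_iff_of_forall_lt [CompleteSpace X] (hd : ∀ i, 0 < K.d i)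
    (hA : ∀ i, IsMaximallyMonotone (A i)) {γ : ℝ} (hγ : 0 < γ) {z : Pow X m} {x : X} {i : Fin n}
    (hx : ∀ j < i, xComp τ K A B γ z j = x) :
    xComp τ K A B γ z i = x ↔
      γ⁻¹ • (kron X K.M z i - K.defect i • x) - forwardTerm τ K B x i ∈ A i x := by
  have hc : 0 < γ / K.d i := div_pos hγ (hd i)
  have h1 : ∀ j : {j : Fin n // j.val < i.val}, xComp τ K A B γ z j.1 = x := fun j => hx _ j.2
  have h2 : ∀ (j : {j : Fin p // j.val < i.val}) (t : {t : Fin n // t.val < j.1.val + τ.val}),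
      xComp τ K A B γ z t.1 = x := fun j t => hx _ (by
    have := t.2; have := j.2; have := τ.2; rw [Fin.lt_def]; omega)
  rw [xComp, ((hA i).scaleOp hc).resolventMap_eq_iff, mem_scaleOp hc.ne']
  simp only [h1, h2]
  rw [← Finset.sum_smul, Coeffs.defect]
  change _ • (_ + _ - _ • forwardTerm τ K B x i - _) ∈ _ ↔ _
  generalize forwardTerm τ K B x i = f
  have h3 := hγ.ne'
  have h4 := (hd i).ne'
  congr! 1
  match_scalars <;> field_simp
  ring

/-- All components of `x^γ(z)` equal `x` if and only if `x` solves a system of inclusions in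
which `γ` only rescales `M z - (a_i x)_i`. -/
theorem forall_xComp_eq_iff [CompleteSpace X] (hd : ∀ i, 0 < K.d i)
    (hA : ∀ i, IsMaximallyMonotone (A i)) {γ : ℝ} (hγ : 0 < γ) {z : Pow X m} {x : X} :
    (∀ i, xComp τ K A B γ z i = x) ↔
      ∀ i, γ⁻¹ • (kron X K.M z i - K.defect i • x) - forwardTerm τ K B x i ∈ A i x := by
  refine ⟨fun h i => (xComp_eq_iff_of_forall_lt hd hA hγ fun j _ => h j).1 (h i), fun h i => ?_⟩
  induction i using WellFoundedLT.induction with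
  | ind i ih => exact (xComp_eq_iff_of_forall_lt hd hA hγ ih).2 (h i)

theorem mem_fixedPoints_fbOp_iff [CompleteSpace X] (hn : 0 < n) (hker : K.KerCondition) {θ γ : ℝ}
    (hθ : θ ≠ 0) {z : Pow X m} :
    z ∈ Function.fixedPoints (fbOp τ K A B θ γ) ↔ ∃ x, ∀ i, xComp τ K A B γ z i = x := by
  rw [Function.mem_fixedPoints, Function.IsFixedPt, fbOp, sub_eq_self, smul_eq_zero_iff_right hθ,
    adjoint_kron, hker.kron_transpose_eq_zero_iff hn]
  rfl

theorem kron_pinv_defect [CompleteSpace X] (hn : 0 < n) (hker : K.KerCondition)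
    (hsum : K.SumCondition) (htri : K.TriangularCondition) (x : X) :
    kron X K.M (pinv (kron X K.M) (WithLp.toLp 2 fun i => K.defect i • x)) =
      WithLp.toLp 2 fun i => K.defect i • x :=
  hker.kron_pinv_apply hn (by simp [← Finset.sum_smul, K.sum_defect hsum htri])

theorem eMap_eq_of_forall_xComp_eq [CompleteSpace X] (hn : 0 < n) (hker : K.KerCondition)
    (hsum : K.SumCondition) (htri : K.TriangularCondition) {γ : ℝ} {z : Pow X m} {x : X}
    (hx : ∀ i, xComp τ K A B γ z i = x) :
    eMap τ K A B γ z = WithLp.toLp 2 fun i => K.defect i • x := by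
  rw [eMap, (isMoorePenrose_pinv_kron K.M).projOnto_range, ← kron_pinv_defect hn hker hsum htri]
  refine congrArg (fun e => kron X K.M (pinv (kron X K.M) (WithLp.toLp 2 e))) (funext fun i => ?_)
  simp only [xMap, hx, ← Finset.sum_smul, ← sub_smul, Coeffs.defect]

/-- Relocation preserves the common value of the components of `x^γ(z)`. -/
theorem xComp_relocator_eq [CompleteSpace X] (hn : 0 < n) (hd : ∀ i, 0 < K.d i)
    (hker : K.KerCondition) (hsum : K.SumCondition) (htri : K.TriangularCondition)
    (hA : ∀ i, IsMaximallyMonotone (A i)) {γ δ : ℝ} (hγ : 0 < γ) (hδ : 0 < δ) {z : Pow X m} {x : X}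
    (hx : ∀ i, xComp τ K A B γ z i = x) (i : Fin n) :
    xComp τ K A B δ (relocator τ K A B δ γ z) i = x := by
  revert i
  rw [forall_xComp_eq_iff hd hA hδ]
  intro i
  have h := (forall_xComp_eq_iff hd hA hγ).1 hx i
  rw [relocator, eMap_eq_of_forall_xComp_eq hn hker hsum htri hx, map_add, map_smul, map_smul,
    kron_pinv_defect hn hker hsum htri]
  convert h using 2
  have h3 := hγ.ne'
  have h4 := hδ.ne'
  simp only [PiLp.add_apply, PiLp.smul_apply]
  match_scalars <;> field_simp
  ring

theorem relocator_self [CompleteSpace X] {γ : ℝ} (hγ : γ ≠ 0) (z : Pow X m) :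
    relocator τ K A B γ γ z = z := by
  simp [relocator, div_self hγ]

theorem relocator_relocator [CompleteSpace X] (hn : 0 < n) (hd : ∀ i, 0 < K.d i)
    (hker : K.KerCondition) (hsum : K.SumCondition) (htri : K.TriangularCondition)
    (hA : ∀ i, IsMaximallyMonotone (A i)) {γ δ : ℝ} (hγ : 0 < γ) (hδ : 0 < δ) (ε : ℝ)
    {z : Pow X m} {x : X} (hx : ∀ i, xComp τ K A B γ z i = x) :
    relocator τ K A B ε δ (relocator τ K A B δ γ z) = relocator τ K A B ε γ z := by
  have hx' := xComp_relocator_eq hn hd hker hsum htri hA hγ hδ hx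
  rw [relocator, eMap_eq_of_forall_xComp_eq hn hker hsum htri hx', relocator, relocator,
    eMap_eq_of_forall_xComp_eq hn hker hsum htri hx]
  have h3 := hγ.ne'
  have h4 := hδ.ne'
  match_scalars <;> field_simp
  ring

end FixedPoints

/-! ### Lipschitz estimates -/

section Lipschitz

variable {X : Type*} [NormedAddCommGroup X] [InnerProductSpace ℝ X] {n m p : ℕ}

/-- For `b = 0` the factor `√b` vanishes, but so does the left-hand side. -/
theorem norm_kron_apply_le {a b : ℕ} (M : Matrix (Fin a) (Fin b) ℝ) (u : Pow X b) (i : Fin a) :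
    ‖kron X M u i‖ ≤ √(b : ℝ) * ‖kron X M‖ * ‖u‖ := by
  rcases b.eq_zero_or_pos with rfl | hb
  · simp [kron_apply]
  · have h1 : 1 ≤ √(b : ℝ) := Real.one_le_sqrt.2 (by exact_mod_cast hb)
    refine ((PiLp.norm_apply_le _ i).trans ((kron X M).le_opNorm u)).trans ?_
    rw [mul_assoc]
    exact le_mul_of_one_le_left (by positivity) h1

theorem norm_sum_smul_le {ι : Type*} [Fintype ι] {a b : ℕ} (S : Matrix (Fin a) (Fin b) ℝ)
    (i : Fin a) (f : ι → Fin b) {v : ι → X} {c : ι → ℝ} (h : ∀ j, ‖v j‖ ≤ c j) :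
    ‖∑ j, S i (f j) • v j‖ ≤ ‖kron X S‖ * ∑ j, c j := by
  rw [Finset.mul_sum]
  exact norm_sum_le_of_le _ fun j _ => (norm_smul_le_norm_kron S i (f j) (v j)).trans
    (mul_le_mul_of_nonneg_left (h j) (norm_nonneg (kron X S)))

variable [CompleteSpace X]
  {τ : Fin 2} {K : Coeffs n m p} {A : Fin n → X → Set X} {B : Fin p → X → X}

theorem norm_xComp_sub_le (hd : ∀ i, 0 < K.d i) (hA : ∀ i, IsMaximallyMonotone (A i))
    {β : ℝ} (hβ : 0 < β) (hB : ∀ j, IsCocoercive β (B j)) {γ : ℝ} (hγ : 0 < γ)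
    (z w : Pow X m) (i : Fin n) :
    ‖xComp τ K A B γ z i - xComp τ K A B γ w i‖ ≤ lipC X τ K β γ i / K.d i * ‖z - w‖ := by
  induction i using WellFoundedLT.induction with
  | ind i ih =>
  have hdi := hd i
  have hN := norm_sum_smul_le K.N i (Subtype.val : {j : Fin n // j.val < i.val} → Fin n)
    fun j => ih j.1 j.2
  have hR : ∀ j : {j : Fin p // j.val < i.val},
      ‖B j.1 (∑ t : {t : Fin n // t.val < j.1.val + τ.val}, K.R j.1 t.1 • xComp τ K A B γ z t.1) -
        B j.1 (∑ t : {t : Fin n // t.val < j.1.val + τ.val}, K.R j.1 t.1 • xComp τ K A B γ w t.1)‖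
      ≤ β * (‖kron X K.R‖ * ∑ t : {t : Fin n // t.val < j.1.val + τ.val},
        lipC X τ K β γ t.1 / K.d t.1 * ‖z - w‖) := fun j => by
    refine ((hB j.1).norm_sub_le hβ _ _).trans (mul_le_mul_of_nonneg_left ?_ hβ.le)
    rw [← Finset.sum_sub_distrib]
    simp only [← smul_sub]
    exact norm_sum_smul_le K.R j.1 Subtype.val fun t => ih t.1 (by
      have := t.2; have := j.2; have := τ.2; rw [Fin.lt_def]; omega)
  have hP := norm_sum_smul_le K.P i (Subtype.val : {j : Fin p // j.val < i.val} → Fin p) hR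
  have hM := norm_kron_apply_le K.M (z - w) i
  simp only [← Finset.sum_mul, ← Finset.mul_sum] at hN hP
  simp only [smul_sub, Finset.sum_sub_distrib, map_sub, PiLp.sub_apply] at hN hP hM
  rw [div_mul_eq_mul_div, le_div_iff₀' hdi]
  rw [xComp, xComp, lipC]
  refine (mul_le_mul_of_nonneg_left
    (((hA i).scaleOp (div_pos hγ hdi)).norm_resolventMap_sub_le _ _) hdi.le).trans ?_
  rw [← Real.norm_of_nonneg hdi.le, ← norm_smul, Real.norm_of_nonneg hdi.le]
  have hP' := mul_le_mul_of_nonneg_left hP hγ.le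
  rw [← Real.norm_of_nonneg hγ.le, ← norm_smul, Real.norm_of_nonneg hγ.le] at hP'
  refine le_trans (le_of_eq (congrArg norm ?_)) ((norm_sub_le_of_le
    (norm_add_le_of_le hM hN) hP').trans (le_of_eq ?_))
  · have h4 := hdi.ne'
    match_scalars <;> field_simp
  · ring

theorem norm_eMap_sub_le (hd : ∀ i, 0 < K.d i) (hA : ∀ i, IsMaximallyMonotone (A i))
    {β : ℝ} (hβ : 0 < β) (hB : ∀ j, IsCocoercive β (B j)) {γ : ℝ} (hγ : 0 < γ)
    (z w : Pow X m) :
    ‖eMap τ K A B γ z - eMap τ K A B γ w‖ ≤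
      √(∑ i : Fin n, (lipC X τ K β γ i + ‖kron X K.N‖ *
        ∑ j : {j : Fin n // j.val < i.val}, lipC X τ K β γ j.1 / K.d j.1) ^ 2) * ‖z - w‖ := by
  have hS := isMoorePenrose_pinv_kron (X := X) K.M
  rw [eMap, eMap, hS.projOnto_range, hS.projOnto_range, ← map_sub, ← map_sub]
  refine (hS.norm_apply_apply_le _).trans ?_
  rw [PiLp.norm_eq_of_L2, ← Real.sqrt_sq (norm_nonneg (z - w)),
    ← Real.sqrt_mul (Finset.sum_nonneg fun i _ => sq_nonneg _), Finset.sum_mul]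
  refine Real.sqrt_le_sqrt (Finset.sum_le_sum fun i _ => ?_)
  rw [← mul_pow]
  refine pow_le_pow_left₀ (norm_nonneg _) ?_ 2
  have hx := fun i => norm_xComp_sub_le (τ := τ) hd hA hβ hB hγ z w i
  have hN := norm_sum_smul_le K.N i (Subtype.val : {j : Fin n // j.val < i.val} → Fin n)
    fun j => hx j.1
  have hD := mul_le_mul_of_nonneg_left (hx i) (hd i).le
  rw [← Real.norm_of_nonneg (hd i).le, ← norm_smul, Real.norm_of_nonneg (hd i).le, ← mul_assoc,
    mul_div_cancel₀ _ (hd i).ne'] at hD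
  simp only [smul_sub, Finset.sum_sub_distrib, ← Finset.sum_mul] at hN hD
  rw [PiLp.sub_apply]
  refine le_trans (le_of_eq (congrArg norm ?_)) ((norm_sub_le_of_le hD hN).trans (le_of_eq ?_))
  · simp only [xMap]
    abel
  · ring

theorem norm_relocator_sub_le (hd : ∀ i, 0 < K.d i) (hA : ∀ i, IsMaximallyMonotone (A i))
    {β : ℝ} (hβ : 0 < β) (hB : ∀ j, IsCocoercive β (B j)) {γ δ : ℝ} (hγ : 0 < γ) (hδ : 0 < δ)
    (z w : Pow X m) :
    ‖relocator τ K A B δ γ z - relocator τ K A B δ γ w‖ ≤ lipL X τ K β δ γ * ‖z - w‖ := by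
  refine le_trans ?_ (mul_le_mul_of_nonneg_right (le_max_right _ _) (norm_nonneg _))
  have h : relocator τ K A B δ γ z - relocator τ K A B δ γ w = (δ / γ) • (z - w) +
      (1 - δ / γ) • pinv (kron X K.M) (eMap τ K A B γ z - eMap τ K A B γ w) := by
    rw [relocator, relocator, map_sub]
    module
  rw [h, add_mul, mul_assoc, mul_assoc]
  refine norm_add_le_of_le ?_ ?_
  · rw [norm_smul, Real.norm_of_nonneg (div_pos hδ hγ).le]
  · rw [norm_smul, Real.norm_eq_abs]
    exact mul_le_mul_of_nonneg_left (((pinv (kron X K.M)).le_opNorm _).trans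
      (mul_le_mul_of_nonneg_left (norm_eMap_sub_le hd hA hβ hB hγ z w) (norm_nonneg _)))
      (abs_nonneg _)

end Lipschitz

end DFB

theorem propositionp {X : Type*} [NormedAddCommGroup X] [InnerProductSpace ℝ X] [CompleteSpace X]
    {n m p : ℕ} (hn : 2 ≤ n) (hp : 1 ≤ p) (τ : Fin 2) (K : DFB.Coeffs n m p)
    (hd : ∀ i, 0 < K.d i) (hker : K.KerCondition) (hsum : K.SumCondition)
    (htri : K.TriangularCondition)
    (A : Fin n → X → Set X) (hA : ∀ i, DFB.IsMaximallyMonotone (A i))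
    (β : ℝ) (hβ : 0 < β) (B : Fin p → X → X) (hB : ∀ j, DFB.IsCocoercive β (B j))
    (θ : ℝ) (hθ : 0 < θ) :
    DFB.IsFixedPointRelocator (Set.Ioi (0 : ℝ)) (fun γ => DFB.fbOp τ K A B θ γ)
      (fun δ γ => DFB.relocator τ K A B δ γ) (fun δ γ => DFB.lipL X τ K β δ γ) := by
  have hn0 : 0 < n := by omega
  have hfix : ∀ {γ : ℝ} {z : DFB.Pow X m}, z ∈ Function.fixedPoints (DFB.fbOp τ K A B θ γ) ↔
      ∃ x, ∀ i, DFB.xComp τ K A B γ z i = x := DFB.mem_fixedPoints_fbOp_iff hn0 hker hθ.ne'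
  have hmaps : ∀ γ ∈ Set.Ioi (0 : ℝ), ∀ δ ∈ Set.Ioi (0 : ℝ),
      Set.MapsTo (DFB.relocator τ K A B δ γ) (Function.fixedPoints (DFB.fbOp τ K A B θ γ))
        (Function.fixedPoints (DFB.fbOp τ K A B θ δ)) := fun γ hγ δ hδ z hz => by
    obtain ⟨x, hx⟩ := hfix.1 hz
    exact hfix.2 ⟨x, DFB.xComp_relocator_eq hn0 hd hker hsum htri hA hγ hδ hx⟩
  have hcomp : ∀ γ ∈ Set.Ioi (0 : ℝ), ∀ δ ∈ Set.Ioi (0 : ℝ), ∀ ε,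
      ∀ z ∈ Function.fixedPoints (DFB.fbOp τ K A B θ γ),
      DFB.relocator τ K A B ε δ (DFB.relocator τ K A B δ γ z) = DFB.relocator τ K A B ε γ z :=
    fun γ hγ δ hδ ε z hz => by
      obtain ⟨x, hx⟩ := hfix.1 hz
      exact DFB.relocator_relocator hn0 hd hker hsum htri hA hγ hδ ε hx
  have hinv : ∀ γ ∈ Set.Ioi (0 : ℝ), ∀ δ ∈ Set.Ioi (0 : ℝ),
      Set.LeftInvOn (DFB.relocator τ K A B γ δ) (DFB.relocator τ K A B δ γ)
        (Function.fixedPoints (DFB.fbOp τ K A B θ γ)) := fun γ hγ δ hδ z hz => by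
    rw [hcomp γ hγ δ hδ γ z hz, DFB.relocator_self (ne_of_gt hγ)]
  exact
    { one_le := fun γ _ δ _ => le_max_left _ _
      bijOn := fun γ hγ δ hδ =>
        Set.InvOn.bijOn ⟨hinv γ hγ δ hδ, hinv δ hδ γ hγ⟩ (hmaps γ hγ δ hδ) (hmaps δ hδ γ hγ)
      continuousOn := fun γ _ z _ => by
        unfold DFB.relocator
        fun_prop
      semigroup := fun γ hγ δ hδ ε _ z hz => hcomp γ hγ δ hδ ε z hz
      lipschitz := fun γ hγ δ hδ z w => DFB.norm_relocator_sub_le hd hA hβ hB hγ hδ z w }
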